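/- **Theorem.** Let $n\ge 1$ and let $\mathbf A$ be a random matrix in GOE$(n)$, i.e. a random real symmetric $n\times n$ matrix whose entries $(a_{ij})_{1\le i\le j\le n}$ on and above the diagonal are independent, with $a_{ii}\sim N(0,2)$ for all $i$ and $a_{ij}\sim N(0,1)$ for $i<j$ (the second parameter is the variance). Let $\mathbf b\in\mathbb R^n$ be a fixed non-zero vector and let $\epsilon>0$; if $n$ is odd, assume in addition that $\epsilon\le\|\mathbf b\|_2$. Put $$P_{\epsilon,\mathbf b}=\mathbb P\bigl(|\langle \mathbf v,\mathbf b\rangle|<\epsilon\ \text{ for some eigenvector } \mathbf v\in\mathbb R^n \text{ of } \mathbf A \text{ with } \|\mathbf v\|_2=1\bigr).$$ Then $$P_{\epsilon,\mathbf b}\le n\left(1-\left(1-\frac{\epsilon}{\|\mathbf b\|_2}\right)^{n-1}\right),$$ where $0^0=1$ (this is needed only for $n=1$, $\epsilon=\|\mathbf b\|_2$). -/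

import Mathlib

open MeasureTheory ProbabilityTheory

/-- The random matrix `A`, defined on the probability space `(Ω, P)`, belongs to `GOE(n)`: it is
(almost surely) symmetric, its diagonal entries are `N(0, 2)`, its entries above the diagonal are
`N(0, 1)` (the second argument of `gaussianReal` is the variance), and the entries on and above the
diagonal are independent. -/
structure IsGOE {Ω : Type*} [MeasurableSpace Ω] (P : Measure Ω) {n : ℕ}
    (A : Ω → Matrix (Fin n) (Fin n) ℝ) : Prop where
  isSymm : ∀ᵐ ω ∂P, (A ω).IsSymm
  hasLaw_diag : ∀ i : Fin n, HasLaw (fun ω => A ω i i) (gaussianReal 0 2) P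
  hasLaw_offDiag : ∀ i j : Fin n, i < j → HasLaw (fun ω => A ω i j) (gaussianReal 0 1) P
  indep : iIndepFun (fun (p : {p : Fin n × Fin n // p.1 ≤ p.2}) (ω : Ω) => A ω p.1.1 p.1.2) P

/-- The probability `P_{ε,b}` that some (real) eigenvector `v` of the random matrix `A` with
Euclidean norm `1` satisfies `|⟨v, b⟩| < ε`, for a deterministic vector `b`. -/
noncomputable def uncontrollability {Ω : Type*} [MeasurableSpace Ω] (P : Measure Ω) {n : ℕ}
    (A : Ω → Matrix (Fin n) (Fin n) ℝ) (b : EuclideanSpace ℝ (Fin n)) (ε : ℝ) : ℝ :=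
  P.real {ω | ∃ (v : EuclideanSpace ℝ (Fin n)) (c : ℝ),
    Module.End.HasEigenvector (Matrix.toEuclideanLin (A ω)) c v ∧ ‖v‖ = 1 ∧ |inner ℝ v b| < ε}

/-! The law of a GOE matrix is invariant under orthogonal conjugation, so the probability depends on
`b` only through `t = ε / ‖b‖`, and `b` may be replaced by a vector `u` uniform in the unit ball and
independent of the matrix. Fix the matrix instead and let `u` vary. Almost surely the spectrum is
simple, so there are only `n` unit eigenvectors up to sign, and a union bound leaves `n` times the
fraction of the ball where `|⟪v, u⟫| < t ‖u‖` for one unit vector `v`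
(`stdGaussian_hasNearlyOrthogonalEigenvector_le`).

That fraction is computed by slicing according to the latitude `φ` relative to `v`: it is the share
of `cos φ ^ (n - 2)` carried by `|sin φ| < t`. It is at most `1 - (1 - t) ^ (n - 1)` by concavity of
sine (`volume_abs_inner_lt_le`).

Simplicity of the spectrum comes from a Krylov determinant that is nonzero for almost every
symmetric matrix (`ae_det_krylov_goeMatrix_ne_zero`). This works for `n ≥ 2` and `t ≤ 1`; the
remaining cases are trivial. -/

/-! ### Trigonometric integrals -/

-- Rescaling the variable gives one factor `c`; concavity on `[0, π]` with `sin 0 = 0` gives `sin (c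
-- x) ≥ c sin x`, hence `k` more.
open Set Real in
theorem pow_mul_integral_sin_pow_le (k : ℕ) {c : ℝ} (hc0 : 0 ≤ c) (hc1 : c ≤ 1) :
    c ^ (k + 1) * ∫ x in (0 : ℝ)..(π / 2), sin x ^ k ≤ ∫ x in (0 : ℝ)..(c * (π / 2)), sin x ^ k := by
  have h : ∫ x in (0 : ℝ)..(c * (π / 2)), sin x ^ k
      = c * ∫ x in (0 : ℝ)..(π / 2), sin (c * x) ^ k := by
    have := intervalIntegral.mul_integral_comp_mul_left (f := fun x => sin x ^ k)
      (a := 0) (b := π / 2) c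
    simpa using this.symm
  rw [h, pow_succ', mul_assoc]
  refine mul_le_mul_of_nonneg_left ?_ hc0
  rw [← intervalIntegral.integral_const_mul]
  refine intervalIntegral.integral_mono_on (by positivity)
    (Continuous.intervalIntegrable (by fun_prop) _ _)
    (Continuous.intervalIntegrable (by fun_prop) _ _) fun x hx => ?_
  rw [← mul_pow]
  have hxπ : x ∈ Icc 0 π := ⟨hx.1, by linarith [hx.2, pi_pos]⟩
  have hs := sin_nonneg_of_mem_Icc hxπ
  refine pow_le_pow_left₀ (mul_nonneg hc0 hs) ?_ k
  have := strictConcaveOn_sin_Icc.concaveOn.2 (left_mem_Icc.2 pi_pos.le) hxπ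
    (sub_nonneg.2 hc1) hc0 (by ring)
  simpa using this

open Set Real in
theorem integral_cos_pow_arcsin_le (k : ℕ) {t : ℝ} (ht0 : 0 ≤ t) (ht1 : t ≤ 1) :
    ∫ x in (-arcsin t)..(arcsin t), cos x ^ k
      ≤ (1 - (1 - t) ^ (k + 1)) * ∫ x in (-(π / 2))..(π / 2), cos x ^ k := by
  have hint : ∀ a b : ℝ, IntervalIntegrable (fun x => cos x ^ k) volume a b := fun a b =>
    Continuous.intervalIntegrable (by fun_prop) _ _
  have heven : ∀ a : ℝ, ∫ x in (-a)..a, cos x ^ k = 2 * ∫ x in (0 : ℝ)..a, cos x ^ k := by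
    intro a
    rw [← intervalIntegral.integral_add_adjacent_intervals (hint (-a) 0) (hint 0 a)]
    have := intervalIntegral.integral_comp_neg (f := fun x => cos x ^ k) (a := 0) (b := a)
    simp only [cos_neg, neg_zero] at this
    rw [← this]; ring
  have hsin : ∀ a : ℝ, ∫ x in (a)..(π / 2), cos x ^ k = ∫ x in (0 : ℝ)..(π / 2 - a), sin x ^ k := by
    intro a
    have := intervalIntegral.integral_comp_sub_left (f := fun x => sin x ^ k) (a := a)
      (b := π / 2) (π / 2)
    simpa [sin_pi_div_two_sub] using this
  set a := arcsin t with ha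
  have ha0 : 0 ≤ a := arcsin_nonneg.2 ht0
  have haπ : a ≤ π / 2 := arcsin_le_pi_div_two t
  have hat : 2 / π * a ≤ t := by
    have := mul_le_sin ha0 haπ
    rwa [ha, sin_arcsin (by linarith) ht1] at this
  have hc : 1 - t ≤ 1 - 2 / π * a := by linarith
  -- Jordan's inequality `2 a / π ≤ sin a = t` makes `c = 1 - 2 a / π` at least `1 - t`, and the
  -- tail beyond `a` is exactly the sine integral up to `c π / 2`.
  have hca : (1 - 2 / π * a) * (π / 2) = π / 2 - a := by field_simp
  have h1 := pow_mul_integral_sin_pow_le k (c := 1 - 2 / π * a) (by linarith)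
    (by linarith [mul_nonneg (div_nonneg zero_le_two pi_pos.le) ha0])
  rw [hca, ← hsin a] at h1
  have h0 := hsin 0
  rw [sub_zero] at h0
  rw [← h0] at h1
  have hnn : 0 ≤ ∫ x in (0 : ℝ)..(π / 2), cos x ^ k := by
    refine intervalIntegral.integral_nonneg (by positivity) fun x hx => ?_
    exact pow_nonneg (cos_nonneg_of_mem_Icc ⟨by linarith [hx.1, pi_pos], hx.2⟩) k
  have h2 : (1 - t) ^ (k + 1) ≤ (1 - 2 / π * a) ^ (k + 1) :=
    pow_le_pow_left₀ (by linarith) hc _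
  have h3 := intervalIntegral.integral_add_adjacent_intervals (hint 0 a) (hint a (π / 2))
  rw [heven, heven]
  nlinarith [mul_le_mul_of_nonneg_right h2 hnn]

/-! ### Volume of a double cone in the unit ball -/

open Set Real in
theorem lintegral_eq_lintegral_mul_tan {r : ℝ} (hr : 0 < r) (g : ℝ → ENNReal) :
    ∫⁻ x, g x = ∫⁻ φ in Ioo (-(π / 2)) (π / 2), ENNReal.ofReal (r / cos φ ^ 2) * g (r * tan φ) := by
  have hd : ∀ x ∈ Ioo (-(π / 2)) (π / 2),
      HasDerivWithinAt (fun φ => r * tan φ) (r / cos x ^ 2) (Ioo (-(π / 2)) (π / 2)) x := by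
    intro x hx
    have := ((hasDerivAt_tan (cos_pos_of_mem_Ioo hx).ne').const_mul r).hasDerivWithinAt
      (s := Ioo (-(π / 2)) (π / 2))
    simpa [div_eq_mul_inv] using this
  have hinj : InjOn (fun φ => r * tan φ) (Ioo (-(π / 2)) (π / 2)) := fun x hx y hy h =>
    injOn_tan hx hy (mul_left_cancel₀ hr.ne' h)
  have himg : (fun φ => r * tan φ) '' Ioo (-(π / 2)) (π / 2) = univ := by
    refine eq_univ_of_forall fun x => ⟨arctan (x / r), arctan_mem_Ioo _, ?_⟩
    simp only [tan_arctan]; field_simp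
  have := lintegral_image_eq_lintegral_abs_deriv_mul measurableSet_Ioo hd hinj g
  rw [himg, setLIntegral_univ] at this
  rw [this]
  refine lintegral_congr fun φ => ?_
  rw [abs_of_nonneg (by positivity)]

/-- The weight `‖y‖` is what the Jacobian of `x = ‖y‖ tan φ` contributes. It is homogeneous of
degree one, which adds one to the scaling exponent of Haar measure. -/
theorem lintegral_norm_indicator_ball {F : Type*} [NormedAddCommGroup F] [NormedSpace ℝ F]
    [MeasurableSpace F] [BorelSpace F] [FiniteDimensional ℝ F] (μ : Measure F)
    [μ.IsAddHaarMeasure] {c : ℝ} (hc : 0 < c) :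
    ∫⁻ y, (Metric.ball 0 c).indicator (fun y => ENNReal.ofReal ‖y‖) y ∂μ
      = ENNReal.ofReal (c ^ (Module.finrank ℝ F + 1))
        * ∫⁻ y, (Metric.ball 0 1).indicator (fun y => ENNReal.ofReal ‖y‖) y ∂μ := by
  set f : F → ENNReal := (Metric.ball 0 c).indicator (fun y => ENNReal.ofReal ‖y‖) with hf
  have hfm : Measurable f := Measurable.indicator (by fun_prop) measurableSet_ball
  have h1 : ∫⁻ y, f (c • y) ∂μ = ENNReal.ofReal ((c ^ Module.finrank ℝ F)⁻¹) * ∫⁻ y, f y ∂μ := by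
    rw [← lintegral_map (g := fun y : F => c • y) hfm (by fun_prop)]
    have := Measure.map_addHaar_smul μ hc.ne'
    rw [this, lintegral_smul_measure, abs_of_pos (by positivity), smul_eq_mul]
  have h2 : ∀ y, f (c • y)
      = ENNReal.ofReal c * (Metric.ball 0 1).indicator (fun y => ENNReal.ofReal ‖y‖) y := by
    intro y
    have hiff : c • y ∈ Metric.ball (0 : F) c ↔ y ∈ Metric.ball (0 : F) 1 := by
      simp only [mem_ball_zero_iff, norm_smul, Real.norm_of_nonneg hc.le]
      exact ⟨fun h => by nlinarith, fun h => by nlinarith⟩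
    by_cases hy : y ∈ Metric.ball (0 : F) 1
    · rw [hf, Set.indicator_of_mem (hiff.2 hy), Set.indicator_of_mem hy, norm_smul,
        Real.norm_of_nonneg hc.le, ENNReal.ofReal_mul hc.le]
    · rw [hf, Set.indicator_of_notMem (fun h => hy (hiff.1 h)), Set.indicator_of_notMem hy,
        mul_zero]
  simp_rw [h2] at h1
  rw [lintegral_const_mul _ (Measurable.indicator (by fun_prop) measurableSet_ball)] at h1
  rw [pow_succ, ENNReal.ofReal_mul (by positivity), mul_assoc, h1, ← mul_assoc,
    ← ENNReal.ofReal_mul (by positivity), mul_inv_cancel₀ (by positivity), ENNReal.ofReal_one,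
    one_mul]

theorem sqrt_mul_tan_sq_add_sq {r φ : ℝ} (hr : 0 < r) (hc : 0 < Real.cos φ) :
    √((r * Real.tan φ) ^ 2 + r ^ 2) = r / Real.cos φ := by
  rw [Real.sqrt_eq_iff_mul_self_eq (by positivity) (by positivity), Real.tan_eq_sin_div_cos]
  field_simp
  linear_combination Real.sin_sq_add_cos_sq φ

/-- The volume, inside the unit ball of `ℝ × F`, of a double cone around the hyperplane `x = 0`,
in terms of the latitude `φ`. -/
theorem lintegral_lintegral_cone {F : Type*} [NormedAddCommGroup F] [NormedSpace ℝ F]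
    [MeasurableSpace F] [BorelSpace F] [FiniteDimensional ℝ F] (μ : Measure F)
    [μ.IsAddHaarMeasure] {k : ℕ} (hk : Module.finrank ℝ F = k + 1) (t : ℝ) :
    ∫⁻ y, (∫⁻ x : ℝ, Set.indicator {x : ℝ | √(x ^ 2 + ‖y‖ ^ 2) < 1 ∧ |x| < t * √(x ^ 2 + ‖y‖ ^ 2)}
        (fun _ => (1 : ENNReal)) x) ∂μ
      = (∫⁻ y, (Metric.ball 0 1).indicator (fun y => ENNReal.ofReal ‖y‖) y ∂μ)
        * ∫⁻ φ in Set.Ioo (-(Real.pi / 2)) (Real.pi / 2),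
            Set.indicator {φ : ℝ | |Real.sin φ| < t}
              (fun φ => ENNReal.ofReal (Real.cos φ ^ k)) φ := by
  have : Nontrivial F := Module.nontrivial_of_finrank_pos (R := ℝ) (by omega)
  have hae : ∀ᵐ y ∂μ, y ≠ 0 := by
    simp [ae_iff]
  -- The integrand after `x = ‖y‖ tan φ`. Since `√(x² + ‖y‖²) = ‖y‖ / cos φ`, the ball becomes `‖y‖
  -- < cos φ`, the cone becomes `|sin φ| < t`, and the Jacobian `‖y‖ / cos² φ` splits between the
  -- two factors.
  set W : ℝ → F → ENNReal := fun φ y =>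
    (Set.indicator {φ : ℝ | |Real.sin φ| < t}
      (fun φ => ENNReal.ofReal ((Real.cos φ ^ 2)⁻¹)) φ) *
    (Set.indicator {p : ℝ × F | ‖p.2‖ < Real.cos p.1} (fun p => ENNReal.ofReal ‖p.2‖) (φ, y))
    with hW
  have hWm : Measurable (Function.uncurry fun y φ => W φ y) := by
    refine Measurable.mul ?_ ?_
    · refine (Measurable.indicator (f := fun φ => ENNReal.ofReal ((Real.cos φ ^ 2)⁻¹))
        (by fun_prop) ?_).comp measurable_snd
      exact measurableSet_lt (by fun_prop) (by fun_prop)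
    · refine (Measurable.indicator (by fun_prop) ?_).comp measurable_swap
      exact measurableSet_lt (by fun_prop) (by fun_prop)
  have h1 : ∀ᵐ y ∂μ, ∫⁻ x : ℝ, Set.indicator
      {x : ℝ | √(x ^ 2 + ‖y‖ ^ 2) < 1 ∧ |x| < t * √(x ^ 2 + ‖y‖ ^ 2)} (fun _ => (1 : ENNReal)) x
      = ∫⁻ φ in Set.Ioo (-(Real.pi / 2)) (Real.pi / 2), W φ y := by
    filter_upwards [hae] with y hy
    have hr : 0 < ‖y‖ := norm_pos_iff.2 hy
    rw [lintegral_eq_lintegral_mul_tan hr]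
    refine setLIntegral_congr_fun measurableSet_Ioo fun φ hφ => ?_
    have hc := Real.cos_pos_of_mem_Ioo hφ
    have hball : √((‖y‖ * Real.tan φ) ^ 2 + ‖y‖ ^ 2) < 1 ↔ ‖y‖ < Real.cos φ := by
      rw [sqrt_mul_tan_sq_add_sq hr hc, div_lt_one hc]
    have hcone : |‖y‖ * Real.tan φ| < t * √((‖y‖ * Real.tan φ) ^ 2 + ‖y‖ ^ 2)
        ↔ |Real.sin φ| < t := by
      rw [sqrt_mul_tan_sq_add_sq hr hc, Real.tan_eq_sin_div_cos, abs_mul, abs_div,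
        abs_of_pos hr, abs_of_pos hc, ← mul_div_assoc, ← mul_div_assoc,
        div_lt_div_iff_of_pos_right hc, mul_comm t, mul_lt_mul_iff_right₀ hr]
    simp only [hW, Set.indicator_apply, Set.mem_ofPred_eq, hball, hcone]
    by_cases ha : |Real.sin φ| < t <;> by_cases hb : ‖y‖ < Real.cos φ <;>
      simp only [ha, hb, and_self, and_true, and_false, if_true, if_false, mul_zero, zero_mul, mul_one]
    rw [div_eq_inv_mul, ENNReal.ofReal_mul (by positivity)]
  rw [lintegral_congr_ae h1, lintegral_lintegral_swap hWm.aemeasurable,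
    mul_comm, ← lintegral_mul_const]
  · refine setLIntegral_congr_fun measurableSet_Ioo fun φ hφ => ?_
    have hc := Real.cos_pos_of_mem_Ioo hφ
    simp only [hW]
    rw [lintegral_const_mul]
    -- The ball of radius `cos φ` yields `cos φ ^ (k + 2)`; the factor `1 / cos² φ` reduces this to
    -- `cos φ ^ k`.
    · have h2 := lintegral_norm_indicator_ball μ hc
      rw [hk] at h2
      have h3 : (fun y => Set.indicator {p : ℝ × F | ‖p.2‖ < Real.cos p.1}
          (fun p => ENNReal.ofReal ‖p.2‖) (φ, y))
          = (Metric.ball 0 (Real.cos φ)).indicator (fun y => ENNReal.ofReal ‖y‖) := by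
        classical ext y; simp only [Set.indicator_apply, Set.mem_ofPred_eq, mem_ball_zero_iff]
      rw [h3, h2, ← mul_assoc]
      congr 1
      by_cases ha : |Real.sin φ| < t
      · simp only [Set.indicator_apply, Set.mem_ofPred_eq, ha, if_true]
        rw [← ENNReal.ofReal_mul (by positivity)]
        congr 1
        field_simp
        ring
      · simp [ha]
    · refine (Measurable.indicator (by fun_prop) ?_).comp measurable_prodMk_left
      exact measurableSet_lt (by fun_prop) (by fun_prop)
  · exact Measurable.indicator (by fun_prop) (measurableSet_lt (by fun_prop) (by fun_prop))

theorem lintegral_cos_pow_indicator_le (k : ℕ) {t : ℝ} (ht0 : 0 ≤ t) (ht1 : t ≤ 1) :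
    ∫⁻ φ in Set.Ioo (-(Real.pi / 2)) (Real.pi / 2),
        Set.indicator {φ : ℝ | |Real.sin φ| < t} (fun φ => ENNReal.ofReal (Real.cos φ ^ k)) φ
      ≤ ENNReal.ofReal (1 - (1 - t) ^ (k + 1))
        * ∫⁻ φ in Set.Ioo (-(Real.pi / 2)) (Real.pi / 2), ENNReal.ofReal (Real.cos φ ^ k) := by
  have key : ∀ a : ℝ, 0 ≤ a → a ≤ Real.pi / 2 →
      ∫⁻ φ in Set.Ioc (-a) a, ENNReal.ofReal (Real.cos φ ^ k)
        = ENNReal.ofReal (∫ φ in (-a)..a, Real.cos φ ^ k) := by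
    intro a ha0 ha
    rw [intervalIntegral.integral_of_le (by linarith), ofReal_integral_eq_lintegral_ofReal]
    · exact ((by fun_prop : Continuous fun x => Real.cos x ^ k).integrableOn_Icc).mono_set
        Set.Ioc_subset_Icc_self
    · refine (ae_restrict_iff' measurableSet_Ioc).2 (Filter.Eventually.of_forall fun x hx => ?_)
      exact pow_nonneg (Real.cos_nonneg_of_mem_Icc ⟨by linarith [hx.1], by linarith [hx.2]⟩) k
  rw [lintegral_indicator (measurableSet_lt (by fun_prop) (by fun_prop)),
    Measure.restrict_restrict (measurableSet_lt (by fun_prop) (by fun_prop))]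
  calc _ ≤ ∫⁻ φ in Set.Ioc (-Real.arcsin t) (Real.arcsin t), ENNReal.ofReal (Real.cos φ ^ k) := by
        refine lintegral_mono_set fun φ hφ => ?_
        have h1 : |Real.sin φ| < t := hφ.1
        have h2 : φ ∈ Set.Icc (-(Real.pi / 2)) (Real.pi / 2) := Set.Ioo_subset_Icc_self hφ.2
        rw [abs_lt] at h1
        constructor
        · rw [← Real.arcsin_neg]
          exact (Real.arcsin_lt_iff_lt_sin' ⟨hφ.2.1, hφ.2.2.le⟩).2 h1.1
        · exact (Real.le_arcsin_iff_sin_le' ⟨hφ.2.1, hφ.2.2.le⟩).2 h1.2.le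
    _ ≤ _ := by
        rw [key _ (Real.arcsin_nonneg.2 ht0) (Real.arcsin_le_pi_div_two t),
          Measure.restrict_congr_set Ioo_ae_eq_Ioc, key _ (by positivity) le_rfl, ← ENNReal.ofReal_mul]
        · exact ENNReal.ofReal_le_ofReal (integral_cos_pow_arcsin_le k ht0 ht1)
        · linarith [pow_le_one₀ (sub_nonneg.2 ht1) (by linarith : 1 - t ≤ 1) (n := k + 1)]

/-- The fraction of the unit ball where `|⟪v, u⟫| < t ‖u‖`, for a unit vector `v`. -/
theorem volume_abs_inner_lt_le {k : ℕ} {t : ℝ} (ht0 : 0 ≤ t) (ht1 : t ≤ 1)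
    {v : EuclideanSpace ℝ (Fin (k + 2))} (hv : ‖v‖ = 1) :
    volume {u : EuclideanSpace ℝ (Fin (k + 2)) | ‖u‖ < 1 ∧ |inner ℝ v u| < t * ‖u‖}
      ≤ ENNReal.ofReal (1 - (1 - t) ^ (k + 1))
        * volume (Metric.ball (0 : EuclideanSpace ℝ (Fin (k + 2))) 1) := by
  let e₀ : EuclideanSpace ℝ (Fin (k + 2)) := EuclideanSpace.single 0 1
  have he₀ : ‖e₀‖ = 1 := by simp [e₀]
  let ρ := (ℝ ∙ (v - e₀))ᗮ.reflection
  have hρ : ρ v = e₀ := Submodule.reflection_sub (by rw [hv, he₀])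
  have hrot : ∀ s : ℝ, volume {u : EuclideanSpace ℝ (Fin (k + 2)) | ‖u‖ < 1 ∧ |inner ℝ v u| < s * ‖u‖}
      = volume {u : EuclideanSpace ℝ (Fin (k + 2)) | ‖u‖ < 1 ∧ |u 0| < s * ‖u‖} := by
    intro s
    have hm : MeasurableSet {u : EuclideanSpace ℝ (Fin (k + 2)) | ‖u‖ < 1 ∧ |u 0| < s * ‖u‖} := by
      rw [Set.ofPred_and]
      exact (measurableSet_lt (by fun_prop) (by fun_prop)).inter
        (measurableSet_lt (by fun_prop) (by fun_prop))
    rw [← ρ.measurePreserving.measure_preimage hm.nullMeasurableSet]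
    congr 1
    ext u
    have : (ρ u) 0 = inner ℝ v u := by
      rw [← ρ.inner_map_map v u, hρ]
      simp [e₀, EuclideanSpace.inner_single_left]
    simp only [Set.mem_ofPred_eq, Set.mem_preimage, this, ρ.norm_map]
  let G : EuclideanSpace ℝ (Fin (k + 2)) → EuclideanSpace ℝ (Fin (k + 1)) × ℝ := fun u =>
    (WithLp.toLp 2 (fun j : Fin (k + 1) => u j.succ), u 0)
  have hG : MeasurePreserving G volume volume := by
    have h1 := PiLp.volume_preserving_ofLp (Fin (k + 2))
    have h2 := volume_preserving_piFinSuccAbove (fun _ : Fin (k + 2) => ℝ) 0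
    have h3 : MeasurePreserving (Prod.swap : ℝ × (Fin (k + 1) → ℝ) → _) volume volume :=
      Measure.measurePreserving_swap
    have h4 := (PiLp.volume_preserving_toLp (Fin (k + 1))).prod
      (MeasurePreserving.id (volume : Measure ℝ))
    exact ((h4.comp h3).comp h2).comp h1
  have hnorm : ∀ u : EuclideanSpace ℝ (Fin (k + 2)), ‖u‖ = √((G u).2 ^ 2 + ‖(G u).1‖ ^ 2) := by
    intro u
    rw [EuclideanSpace.norm_eq, Fin.sum_univ_succ, EuclideanSpace.norm_sq_eq]
    simp [G]
  have hcone : ∀ s : ℝ, volume {u : EuclideanSpace ℝ (Fin (k + 2)) | ‖u‖ < 1 ∧ |u 0| < s * ‖u‖}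
      = (∫⁻ y : EuclideanSpace ℝ (Fin (k + 1)),
          (Metric.ball 0 1).indicator (fun y => ENNReal.ofReal ‖y‖) y)
        * ∫⁻ φ in Set.Ioo (-(Real.pi / 2)) (Real.pi / 2),
            Set.indicator {φ : ℝ | |Real.sin φ| < s}
              (fun φ => ENNReal.ofReal (Real.cos φ ^ k)) φ := by
    intro s
    rw [← lintegral_lintegral_cone volume (by simp) s]
    let S : Set (EuclideanSpace ℝ (Fin (k + 1)) × ℝ) :=
      {p | √(p.2 ^ 2 + ‖p.1‖ ^ 2) < 1 ∧ |p.2| < s * √(p.2 ^ 2 + ‖p.1‖ ^ 2)}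
    have hS : MeasurableSet S := by
      simp only [S, Set.ofPred_and]
      exact (measurableSet_lt (by fun_prop) (by fun_prop)).inter
        (measurableSet_lt (by fun_prop) (by fun_prop))
    have hpre : {u : EuclideanSpace ℝ (Fin (k + 2)) | ‖u‖ < 1 ∧ |u 0| < s * ‖u‖} = G ⁻¹' S := by
      ext u
      simp only [S, Set.mem_preimage, Set.mem_ofPred_eq, ← hnorm]
      rfl
    rw [hpre, hG.measure_preimage hS.nullMeasurableSet]
    change (Measure.prod volume volume) S = _
    rw [Measure.prod_apply hS]
    refine lintegral_congr fun y => ?_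
    rw [← lintegral_indicator_one (measurable_prodMk_left hS)]
    rfl
  have hball : (∫⁻ y : EuclideanSpace ℝ (Fin (k + 1)),
        (Metric.ball 0 1).indicator (fun y => ENNReal.ofReal ‖y‖) y)
        * ∫⁻ φ in Set.Ioo (-(Real.pi / 2)) (Real.pi / 2), ENNReal.ofReal (Real.cos φ ^ k)
      ≤ volume (Metric.ball (0 : EuclideanSpace ℝ (Fin (k + 2))) 1) := by
    -- With `s = 2` the latitude condition is vacuous, so `hcone` also computes the normalising
    -- constant. The origin fails the strict inequality, but an upper bound by the ball is enough.
    have h2 : ∀ φ : ℝ, |Real.sin φ| < 2 := fun φ =>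
      (Real.abs_sin_le_one φ).trans_lt one_lt_two
    have := hcone 2
    simp only [h2, Set.ofPred_true, Set.indicator_univ] at this
    rw [← this]
    exact measure_mono fun u hu => mem_ball_zero_iff.2 hu.1
  rw [hrot, hcone]
  calc _ ≤ _ * (ENNReal.ofReal (1 - (1 - t) ^ (k + 1))
        * ∫⁻ φ in Set.Ioo (-(Real.pi / 2)) (Real.pi / 2), ENNReal.ofReal (Real.cos φ ^ k)) :=
        mul_le_mul_right (lintegral_cos_pow_indicator_le k ht0 ht1) _
    _ ≤ _ := by
        rw [mul_left_comm]
        exact mul_le_mul_right hball _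

/-! ### Krylov matrices and simple spectrum -/

/-- The matrix with rows `Mᵏ w`, for `k < n`. -/
def Matrix.krylov {R : Type*} [CommRing R] {n : ℕ} (M : Matrix (Fin n) (Fin n) R) (w : Fin n → R) :
    Matrix (Fin n) (Fin n) R :=
  Matrix.of fun k => (M ^ (k : ℕ)).mulVec w

theorem Matrix.pow_mulVec_of_mulVec_eq_smul {R : Type*} [CommRing R] {n : ℕ}
    {M : Matrix (Fin n) (Fin n) R} {v : Fin n → R} {c : R} (h : M.mulVec v = c • v) (k : ℕ) :
    (M ^ k).mulVec v = c ^ k • v := by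
  induction k with
  | zero => simp
  | succ k ih => rw [pow_succ, ← Matrix.mulVec_mulVec, h, Matrix.mulVec_smul, ih, smul_smul,
      pow_succ']

/-- By symmetry an eigenvector orthogonal to `w` is orthogonal to every `M ^ k w`, and these span.
Consequently no eigenspace can have dimension two: it would meet the hyperplane orthogonal to `w`.
-/
theorem Matrix.IsSymm.eq_zero_of_det_krylov_ne_zero {n : ℕ}
    {M : Matrix (Fin n) (Fin n) ℝ} (hM : M.IsSymm) {w : Fin n → ℝ} (hK : (M.krylov w).det ≠ 0)
    {v : Fin n → ℝ} {c : ℝ} (h : M.mulVec v = c • v) (hvw : v ⬝ᵥ w = 0) : v = 0 := by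
  refine Matrix.eq_zero_of_mulVec_eq_zero hK ?_
  ext k
  change (M ^ (k : ℕ)).mulVec w ⬝ᵥ v = 0
  rw [dotProduct_comm, Matrix.dotProduct_mulVec, ← Matrix.mulVec_transpose, Matrix.transpose_pow,
    hM.eq, Matrix.pow_mulVec_of_mulVec_eq_smul h, smul_dotProduct, hvw, smul_zero]

theorem Matrix.krylov_map {R S : Type*} [CommRing R] [CommRing S] {n : ℕ} (f : R →+* S)
    (M : Matrix (Fin n) (Fin n) R) (w : Fin n → R) :
    (M.krylov w).map f = (M.map f).krylov (f ∘ w) := by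
  ext k i
  simp only [Matrix.krylov, Matrix.map_apply, Matrix.of_apply]
  have : (M.map f) ^ (k : ℕ) = (M ^ (k : ℕ)).map f := (map_pow f.mapMatrix M k).symm
  rw [this, ← RingHom.map_mulVec]

theorem Matrix.det_krylov_smul {R : Type*} [CommRing R] {n : ℕ} (M : Matrix (Fin n) (Fin n) R)
    (w : Fin n → R) (c : R) :
    ((c • M).krylov w).det = (∏ k : Fin n, c ^ (k : ℕ)) * (M.krylov w).det := by
  rw [← Matrix.det_mul_column]
  congr 1
  ext k i
  simp [Matrix.krylov, smul_pow, Matrix.smul_mulVec]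

theorem Matrix.det_krylov_diagonal_ne_zero {n : ℕ} {d : Fin n → ℝ} (hd : Function.Injective d) :
    ((Matrix.diagonal d).krylov (fun _ => 1)).det ≠ 0 := by
  have : (Matrix.diagonal d).krylov (fun _ => 1) = (Matrix.vandermonde d).transpose := by
    ext k i
    simp [Matrix.krylov, Matrix.diagonal_pow, Matrix.mulVec_diagonal, Matrix.vandermonde_apply]
  rw [this, Matrix.det_transpose]
  exact Matrix.det_vandermonde_ne_zero_iff.2 hd

theorem Matrix.finite_setOf_det_krylov_add_smul_eq_zero {n : ℕ} (M D : Matrix (Fin n) (Fin n) ℝ)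
    (w : Fin n → ℝ) (hD : (D.krylov w).det ≠ 0) :
    {x : ℝ | ((M + x • D).krylov w).det = 0}.Finite := by
  -- The roles of `M` and `D` are reversed: `q` is nonzero because its value at `0` is the
  -- determinant for `D`, and homogeneity of the Krylov determinant turns a zero `x ≠ 0` into the
  -- root `x⁻¹` of `q`.
  let q : Polynomial ℝ :=
    ((D.map Polynomial.C + (Polynomial.X : Polynomial ℝ) • M.map Polynomial.C).krylov
      (Polynomial.C ∘ w)).det
  have heval : ∀ y : ℝ, q.eval y = ((D + y • M).krylov w).det := by
    intro y
    have h1 := RingHom.map_det (Polynomial.evalRingHom y)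
      ((D.map Polynomial.C + (Polynomial.X : Polynomial ℝ) • M.map Polynomial.C).krylov
        (Polynomial.C ∘ w))
    rw [RingHom.mapMatrix_apply, Matrix.krylov_map] at h1
    change q.eval y = _ at h1
    rw [h1]
    congr 2
    · ext i j; simp; ring
    · ext i; simp
  have hq : q ≠ 0 := by
    intro h
    apply hD
    have := heval 0
    rw [h] at this
    simpa using this.symm
  refine ((Set.finite_singleton (0 : ℝ)).union
    ((q.roots.toFinset.finite_toSet).preimage (f := fun x : ℝ => x⁻¹)
      inv_injective.injOn)).subset fun x hx => ?_
  by_cases hx0 : x = 0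
  · exact Or.inl hx0
  · right
    have h2 : M + x • D = x • (D + x⁻¹ • M) := by
      rw [smul_add, smul_smul, mul_inv_cancel₀ hx0, one_smul, add_comm]
    have h3 : ((M + x • D).krylov w).det = 0 := hx
    rw [h2, Matrix.det_krylov_smul, ← heval] at h3
    have h4 : q.eval x⁻¹ = 0 := (mul_eq_zero.1 h3).resolve_left
      (Finset.prod_ne_zero_iff.2 fun k _ => pow_ne_zero _ hx0)
    simp [hq, h4]

theorem Matrix.mulVec_of_hasEigenvector {n : ℕ} {M : Matrix (Fin n) (Fin n) ℝ} {c : ℝ}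
    {v : EuclideanSpace ℝ (Fin n)} (h : Module.End.HasEigenvector M.toEuclideanLin c v) :
    M.mulVec v.ofLp = c • v.ofLp := by
  have := congrArg WithLp.ofLp h.apply_eq_smul
  simpa using this

/-- If the Krylov matrix of `M` is invertible, then every unit eigenvector of `M` is, up to sign,
a member of the given eigenvector basis. -/
theorem Matrix.IsHermitian.exists_abs_inner_eigenvectorBasis_eq {n : ℕ}
    {M : Matrix (Fin n) (Fin n) ℝ} (hM : M.IsHermitian) {w : Fin n → ℝ}
    (hK : (M.krylov w).det ≠ 0) {v : EuclideanSpace ℝ (Fin n)} {c : ℝ}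
    (h : Module.End.HasEigenvector M.toEuclideanLin c v) (hv : ‖v‖ = 1) :
    ∃ i, ∀ u : EuclideanSpace ℝ (Fin n), |inner ℝ (hM.eigenvectorBasis i) u| = |inner ℝ v u| := by
  have hsymm : M.IsSymm := hM
  have hv0 : v ≠ 0 := h.2
  obtain ⟨i, hi⟩ : ∃ i, inner ℝ (hM.eigenvectorBasis i) v ≠ 0 := by
    by_contra! hall
    exact hv0 (hM.eigenvectorBasis.repr.injective (by
      ext i; simpa [OrthonormalBasis.repr_apply_apply] using hall i))
  set e := hM.eigenvectorBasis i with he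
  have hMv := M.mulVec_of_hasEigenvector h
  have hMe : M.mulVec e.ofLp = hM.eigenvalues i • e.ofLp := hM.mulVec_eigenvectorBasis i
  have hc : hM.eigenvalues i = c := by
    have h1 : v.ofLp ⬝ᵥ M.mulVec e.ofLp = M.mulVec v.ofLp ⬝ᵥ e.ofLp := by
      rw [Matrix.dotProduct_mulVec, ← Matrix.mulVec_transpose, hsymm.eq]
    rw [hMv, hMe, dotProduct_smul, smul_dotProduct, smul_eq_mul, smul_eq_mul] at h1
    refine mul_right_cancel₀ ?_ h1
    simpa [EuclideanSpace.inner_eq_star_dotProduct] using hi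
  -- This combination lies in the eigenspace of `c` and is orthogonal to `w`.
  have hz : (v.ofLp ⬝ᵥ w) • e.ofLp - (e.ofLp ⬝ᵥ w) • v.ofLp = 0 := by
    refine hsymm.eq_zero_of_det_krylov_ne_zero hK (c := c) ?_ ?_
    · rw [Matrix.mulVec_sub, Matrix.mulVec_smul, Matrix.mulVec_smul, hMe, hMv, hc, smul_sub,
        smul_comm c, smul_comm c]
    · rw [sub_dotProduct, smul_dotProduct, smul_dotProduct, smul_eq_mul, smul_eq_mul]
      ring
  have hz' : (v.ofLp ⬝ᵥ w) • e = (e.ofLp ⬝ᵥ w) • v := by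
    have := congrArg (WithLp.toLp 2) (sub_eq_zero.1 hz)
    simpa using this
  have hvw : v.ofLp ⬝ᵥ w ≠ 0 := fun h0 => hv0 (by
    have := hsymm.eq_zero_of_det_krylov_ne_zero hK hMv h0
    simpa using congrArg (WithLp.toLp 2) this)
  have hen : ‖e‖ = 1 := hM.eigenvectorBasis.orthonormal.1 i
  have habs : |v.ofLp ⬝ᵥ w| = |e.ofLp ⬝ᵥ w| := by
    have := congrArg norm hz'
    simpa [norm_smul, hen, hv] using this
  refine ⟨i, fun u => mul_left_cancel₀ (abs_ne_zero.2 hvw) ?_⟩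
  rw [← he, ← abs_mul, ← real_inner_smul_left, hz', real_inner_smul_left, abs_mul, habs]

/-! ### Absolute continuity of the standard Gaussian measure -/

theorem MeasureTheory.Measure.pi_mono {ι : Type*} [Fintype ι] {α : ι → Type*}
    [∀ i, MeasurableSpace (α i)] {μ ν : ∀ i, Measure (α i)} [∀ i, SigmaFinite (μ i)]
    (h : ∀ i, μ i ≤ ν i) : Measure.pi μ ≤ Measure.pi ν := by
  refine Measure.le_iff.2 fun s hs => ?_
  rw [Measure.pi_def ν, toMeasure_apply _ _ hs]
  suffices (Measure.pi μ).toOuterMeasure ≤ OuterMeasure.pi fun i => (ν i).toOuterMeasure from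
    this s
  rw [OuterMeasure.le_pi]
  intro t _
  exact (Measure.pi_pi μ t).le.trans (Finset.prod_le_prod' fun i _ => h i (t i))

theorem gaussianReal_zero_one_le : gaussianReal 0 1 ≤ volume := by
  rw [gaussianReal_of_var_ne_zero 0 one_ne_zero]
  refine Measure.le_iff.2 fun s hs => ?_
  rw [withDensity_apply _ hs, ← setLIntegral_one]
  refine lintegral_mono fun x => ?_
  rw [gaussianPDF, ← ENNReal.ofReal_one]
  refine ENNReal.ofReal_le_ofReal ?_
  rw [gaussianPDFReal]
  refine mul_le_one₀ (inv_le_one_of_one_le₀ ?_) (Real.exp_pos _).le (Real.exp_le_one_iff.2 ?_)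
  · rw [Real.one_le_sqrt]
    norm_num
    linarith [Real.pi_gt_three]
  · rw [neg_div]
    exact neg_nonpos.2 (div_nonneg (sq_nonneg _) (by norm_num))

/-- Each coordinate has density at most `1 / √(2π) ≤ 1`, and domination passes to finite products.
It serves to transfer Lebesgue-null sets to the Gaussian measure. -/
theorem stdGaussian_le_volume (ι : Type*) [Fintype ι] :
    stdGaussian (EuclideanSpace ℝ ι) ≤ volume := by
  rw [← map_pi_eq_stdGaussian, ← (PiLp.volume_preserving_toLp ι).map_eq]
  exact Measure.map_mono (Measure.pi_mono fun _ => gaussianReal_zero_one_le)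
    (PiLp.volume_preserving_toLp ι).measurable

/-! ### Symmetric matrices as a Euclidean space -/

/-- The normalisation of the entries: `√2` on the diagonal and `1` off the diagonal. -/
noncomputable def goeScale {n : ℕ} (i j : Fin n) : ℝ := if i = j then √2 else 1

theorem goeScale_pos {n : ℕ} (i j : Fin n) : 0 < goeScale i j := by
  unfold goeScale; split_ifs <;> positivity

theorem goeScale_comm {n : ℕ} (i j : Fin n) : goeScale i j = goeScale j i := by
  simp [goeScale, eq_comm]

/-- The symmetric matrix with given normalised entries on and above the diagonal. -/
noncomputable def goeMatrix (n : ℕ) :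
    EuclideanSpace ℝ {p : Fin n × Fin n // p.1 ≤ p.2} →ₗ[ℝ] Matrix (Fin n) (Fin n) ℝ where
  toFun Y := Matrix.of fun i j => goeScale i j * Y ⟨(min i j, max i j), min_le_max⟩
  map_add' Y Z := by ext i j; simp [mul_add]
  map_smul' c Y := by ext i j; simp [mul_left_comm]

/-- The normalised entries on and above the diagonal. -/
noncomputable def goeCoord (n : ℕ) :
    Matrix (Fin n) (Fin n) ℝ →ₗ[ℝ] EuclideanSpace ℝ {p : Fin n × Fin n // p.1 ≤ p.2} where
  toFun M := WithLp.toLp 2 fun p => M p.1.1 p.1.2 / goeScale p.1.1 p.1.2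
  map_add' M N := by ext p; simp [add_div]
  map_smul' c M := by ext p; simp [mul_div_assoc]

theorem goeMatrix_apply {n : ℕ} (Y : EuclideanSpace ℝ {p : Fin n × Fin n // p.1 ≤ p.2})
    (i j : Fin n) :
    goeMatrix n Y i j = goeScale i j * Y ⟨(min i j, max i j), min_le_max⟩ := rfl

theorem isSymm_goeMatrix {n : ℕ} (Y : EuclideanSpace ℝ {p : Fin n × Fin n // p.1 ≤ p.2}) :
    (goeMatrix n Y).IsSymm := by
  ext i j
  rw [Matrix.transpose_apply, goeMatrix_apply, goeMatrix_apply, goeScale_comm]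
  simp only [min_comm, max_comm]

theorem goeMatrix_goeCoord {n : ℕ} {M : Matrix (Fin n) (Fin n) ℝ} (hM : M.IsSymm) :
    goeMatrix n (goeCoord n M) = M := by
  ext i j
  rw [goeMatrix_apply]
  change goeScale i j * (M (min i j) (max i j) / goeScale (min i j) (max i j)) = M i j
  have := (goeScale_pos i j).ne'
  rcases le_total i j with h | h
  · rw [min_eq_left h, max_eq_right h]; field_simp
  · rw [min_eq_right h, max_eq_left h, goeScale_comm j i, hM.apply]; field_simp

/-- Off-diagonal entries occur twice and diagonal ones once with scale `√2`. This is why variance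
`2` on the diagonal gives a rotation-invariant law. -/
theorem sum_sq_goeMatrix {n : ℕ} (Y : EuclideanSpace ℝ {p : Fin n × Fin n // p.1 ≤ p.2}) :
    ∑ i, ∑ j, goeMatrix n Y i j ^ 2 = 2 * ‖Y‖ ^ 2 := by
  have h1 : ‖Y‖ ^ 2 = ∑ i, ∑ j, if i ≤ j then Y ⟨(min i j, max i j), min_le_max⟩ ^ 2 else 0 := by
    rw [EuclideanSpace.real_norm_sq_eq, ← Fintype.sum_prod_type',
      ← Finset.sum_filter]
    refine Finset.sum_bij (fun p _ => p.1) (fun p _ => by simpa using p.2)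
      (fun p _ q _ h => Subtype.ext h) (fun p hp => ⟨⟨p, by simpa using hp⟩, by simp⟩) ?_
    rintro ⟨⟨i, j⟩, h : i ≤ j⟩ _
    simp only [min_eq_left h, max_eq_right h]
  have h2 : ∑ i, ∑ j, (if j < i then goeMatrix n Y i j ^ 2 else 0)
      = ∑ i, ∑ j, (if i < j then goeMatrix n Y i j ^ 2 else 0) := by
    rw [Finset.sum_comm]
    refine Finset.sum_congr rfl fun i _ => Finset.sum_congr rfl fun j _ => ?_
    rw [(isSymm_goeMatrix Y).apply]
  have h3 : ∀ i j, goeMatrix n Y i j ^ 2 = (if i ≤ j then goeMatrix n Y i j ^ 2 else 0)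
      + if j < i then goeMatrix n Y i j ^ 2 else 0 := by
    intro i j
    rcases le_or_gt i j with h | h
    · simp [h, not_lt.2 h]
    · simp [h, not_le.2 h]
  rw [Finset.sum_congr rfl fun i _ => Finset.sum_congr rfl fun j _ => h3 i j]
  simp_rw [Finset.sum_add_distrib]
  rw [h2, h1, Finset.mul_sum, ← Finset.sum_add_distrib]
  refine Finset.sum_congr rfl fun i _ => ?_
  rw [Finset.mul_sum, ← Finset.sum_add_distrib]
  refine Finset.sum_congr rfl fun j _ => ?_
  rw [goeMatrix_apply]
  rcases lt_trichotomy i j with h | h | h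
  · rw [if_pos h.le, if_pos h, if_pos h.le, goeScale, if_neg h.ne, one_mul, two_mul]
  · subst h; simp [goeScale, mul_pow]
  · simp [not_le.2 h, not_lt.2 h.le]

theorem Matrix.sum_sq_eq_trace {n : ℕ} (M : Matrix (Fin n) (Fin n) ℝ) :
    ∑ i, ∑ j, M i j ^ 2 = (M * M.transpose).trace := by
  simp [Matrix.trace, Matrix.mul_apply, pow_two]

/-- Conjugation by a symmetric involution preserves symmetry and the Frobenius norm, so it is an
isometry in normalised coordinates and fixes the standard Gaussian. -/
theorem exists_linearIsometryEquiv_goeMatrix {n : ℕ} {Q : Matrix (Fin n) (Fin n) ℝ}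
    (hQ : Q.IsSymm) (hQ2 : Q * Q = 1) :
    ∃ ρ : EuclideanSpace ℝ {p : Fin n × Fin n // p.1 ≤ p.2} ≃ₗᵢ[ℝ]
        EuclideanSpace ℝ {p : Fin n × Fin n // p.1 ≤ p.2},
      ∀ Y, goeMatrix n (ρ Y) = Q * goeMatrix n Y * Q := by
  let f : EuclideanSpace ℝ {p : Fin n × Fin n // p.1 ≤ p.2} →ₗ[ℝ]
        EuclideanSpace ℝ {p : Fin n × Fin n // p.1 ≤ p.2} :=
    goeCoord n ∘ₗ LinearMap.mulRight ℝ Q ∘ₗ LinearMap.mulLeft ℝ Q ∘ₗ goeMatrix n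
  have hf : ∀ Y, goeMatrix n (f Y) = Q * goeMatrix n Y * Q := by
    intro Y
    refine goeMatrix_goeCoord (M := Q * goeMatrix n Y * Q) ?_
    rw [Matrix.IsSymm, Matrix.transpose_mul, Matrix.transpose_mul, hQ.eq,
      (isSymm_goeMatrix Y).eq, Matrix.mul_assoc]
  have hnorm : ∀ Y, ‖f Y‖ = ‖Y‖ := by
    intro Y
    have h1 := sum_sq_goeMatrix (f Y)
    rw [hf, Matrix.sum_sq_eq_trace, Matrix.transpose_mul, Matrix.transpose_mul, hQ.eq,
      Matrix.mul_assoc (Q * goeMatrix n Y) Q, ← Matrix.mul_assoc Q Q, hQ2, Matrix.one_mul,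
      ← Matrix.mul_assoc, Matrix.trace_mul_comm, ← Matrix.mul_assoc, ← Matrix.mul_assoc, hQ2,
      Matrix.one_mul, ← Matrix.sum_sq_eq_trace, sum_sq_goeMatrix] at h1
    exact ((pow_left_inj₀ (norm_nonneg _) (norm_nonneg _) two_ne_zero).1 (by linarith)).symm
  exact ⟨(LinearIsometry.mk f hnorm).toLinearIsometryEquiv rfl, hf⟩

/-- Householder reflections act transitively on the vectors of a given norm. -/
theorem exists_householder {n : ℕ} {u b : Fin n → ℝ} (h : u ⬝ᵥ u = b ⬝ᵥ b) :
    ∃ Q : Matrix (Fin n) (Fin n) ℝ, Q.IsSymm ∧ Q * Q = 1 ∧ Q.mulVec u = b := by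
  by_cases hub : u = b
  · exact ⟨1, Matrix.isSymm_one, one_mul 1, by simp [hub]⟩
  set w := u - b with hw
  have hw0 : w ⬝ᵥ w ≠ 0 := fun h0 => hub (sub_eq_zero.1 (dotProduct_self_eq_zero.1 h0))
  refine ⟨1 - (2 / (w ⬝ᵥ w)) • Matrix.vecMulVec w w, ?_, ?_, ?_⟩
  · simp [Matrix.IsSymm, Matrix.transpose_sub, Matrix.transpose_vecMulVec]
  · have hV : Matrix.vecMulVec w w * Matrix.vecMulVec w w
        = (w ⬝ᵥ w) • Matrix.vecMulVec w w := by
      rw [Matrix.vecMulVec_mul_vecMulVec, Matrix.vecMulVec_smul]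
    rw [Matrix.sub_mul, Matrix.one_mul, Matrix.mul_sub, Matrix.mul_one, Matrix.smul_mul,
      Matrix.mul_smul, hV, smul_smul, smul_smul, mul_assoc,
      div_mul_cancel₀ _ hw0, mul_two, add_smul]
    abel
  -- Equality of the norms of `u` and `b` enters here.
  · have h2 : w ⬝ᵥ w = 2 * (w ⬝ᵥ u) := by
      rw [hw]
      simp only [sub_dotProduct, dotProduct_sub, ← h, dotProduct_comm b u]
      ring
    rw [Matrix.sub_mulVec, Matrix.one_mulVec, Matrix.smul_mulVec, Matrix.vecMulVec_mulVec]
    ext i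
    simp only [Pi.sub_apply, Pi.smul_apply, smul_eq_mul, MulOpposite.smul_eq_mul_unop,
      MulOpposite.unop_op]
    rw [h2] at hw0 ⊢
    have : w ⬝ᵥ u ≠ 0 := fun h0 => hw0 (by rw [h0, mul_zero])
    field_simp
    simp [hw]

/-! ### The random matrix in normalised coordinates -/

theorem IsGOE.hasLaw_goeCoord {Ω : Type*} [MeasurableSpace Ω] {P : Measure Ω} {n : ℕ}
    {A : Ω → Matrix (Fin n) (Fin n) ℝ} (hA : IsGOE P A) :
    HasLaw (fun ω => goeCoord n (A ω)) (stdGaussian _) P := by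
  have hlaw : ∀ p : {p : Fin n × Fin n // p.1 ≤ p.2},
      HasLaw (fun ω => A ω p.1.1 p.1.2 / goeScale p.1.1 p.1.2) (gaussianReal 0 1) P := by
    rintro ⟨⟨i, j⟩, h : i ≤ j⟩
    rcases h.eq_or_lt with rfl | h
    · have := gaussianReal_div_const (hA.hasLaw_diag i) √2
      have h2 : (2 : NNReal) / NNReal.mk (√2 ^ 2) (sq_nonneg _) = 1 := by
        apply NNReal.eq
        rw [NNReal.coe_div, NNReal.coe_mk, Real.sq_sqrt zero_le_two, NNReal.coe_ofNat,
          div_self two_ne_zero, NNReal.coe_one]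
      rw [zero_div, h2] at this
      simpa [goeScale] using this
    · simpa [goeScale, h.ne] using hA.hasLaw_offDiag i j h
  have hind := hA.indep.comp (fun p x => x / goeScale p.1.1 p.1.2) (fun p => by fun_prop)
  have hpi := iIndepFun.hasLaw_pi hlaw hind
  have hlp : HasLaw (WithLp.toLp 2 : ({p : Fin n × Fin n // p.1 ≤ p.2} → ℝ) → _)
      (stdGaussian (EuclideanSpace ℝ {p : Fin n × Fin n // p.1 ≤ p.2}))
      (Measure.pi fun _ => gaussianReal 0 1) := ⟨by fun_prop, map_pi_eq_stdGaussian⟩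
  exact hlp.comp hpi

/-! ### Eigenvectors nearly orthogonal to a given vector -/

/-- Some unit eigenvector `v` of `M` satisfies `|⟪v, u⟫| < t ‖u‖`. -/
def HasNearlyOrthogonalEigenvector {n : ℕ} (M : Matrix (Fin n) (Fin n) ℝ) (t : ℝ)
    (u : EuclideanSpace ℝ (Fin n)) : Prop :=
  ∃ (v : EuclideanSpace ℝ (Fin n)) (c : ℝ),
    Module.End.HasEigenvector M.toEuclideanLin c v ∧ ‖v‖ = 1 ∧ |inner ℝ v u| < t * ‖u‖

theorem HasNearlyOrthogonalEigenvector.smul {n : ℕ} {M : Matrix (Fin n) (Fin n) ℝ} {t : ℝ}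
    {u : EuclideanSpace ℝ (Fin n)} (h : HasNearlyOrthogonalEigenvector M t u) {r : ℝ}
    (hr : 0 < r) : HasNearlyOrthogonalEigenvector M t (r • u) := by
  obtain ⟨v, c, h1, h2, h3⟩ := h
  refine ⟨v, c, h1, h2, ?_⟩
  rw [real_inner_smul_right, abs_mul, abs_of_pos hr, norm_smul, Real.norm_of_nonneg hr.le,
    mul_left_comm]
  exact mul_lt_mul_of_pos_left h3 hr

theorem HasNearlyOrthogonalEigenvector.conj {n : ℕ} {M : Matrix (Fin n) (Fin n) ℝ} {t : ℝ}
    {u : EuclideanSpace ℝ (Fin n)} (h : HasNearlyOrthogonalEigenvector M t u)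
    {Q : Matrix (Fin n) (Fin n) ℝ} (hQ : Q.IsSymm) (hQ2 : Q * Q = 1) :
    HasNearlyOrthogonalEigenvector (Q * M * Q) t (WithLp.toLp 2 (Q.mulVec u.ofLp)) := by
  obtain ⟨v, c, h1, h2, h3⟩ := h
  have hinner : ∀ x y : EuclideanSpace ℝ (Fin n),
      inner ℝ (WithLp.toLp 2 (Q.mulVec x.ofLp) : EuclideanSpace ℝ (Fin n))
        (WithLp.toLp 2 (Q.mulVec y.ofLp)) = inner ℝ x y := by
    intro x y
    simp only [EuclideanSpace.inner_eq_star_dotProduct, star_trivial]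
    rw [Matrix.dotProduct_mulVec, ← Matrix.mulVec_transpose, hQ.eq, Matrix.mulVec_mulVec, hQ2,
      Matrix.one_mulVec]
  have hnorm : ∀ x : EuclideanSpace ℝ (Fin n),
      ‖(WithLp.toLp 2 (Q.mulVec x.ofLp) : EuclideanSpace ℝ (Fin n))‖ = ‖x‖ := by
    intro x
    rw [norm_eq_sqrt_real_inner, hinner, ← norm_eq_sqrt_real_inner]
  refine ⟨WithLp.toLp 2 (Q.mulVec v.ofLp), c, ⟨?_, ?_⟩, by rw [hnorm, h2], by rwa [hinner, hnorm]⟩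
  · rw [Module.End.mem_eigenspace_iff, Matrix.toLpLin_toLp, Matrix.toLin'_apply,
      Matrix.mulVec_mulVec, Matrix.mul_assoc, hQ2, Matrix.mul_one, ← Matrix.mulVec_mulVec,
      M.mulVec_of_hasEigenvector h1, Matrix.mulVec_smul, WithLp.toLp_smul]
  · rw [← norm_ne_zero_iff, hnorm, h2]
    exact one_ne_zero

/-- The eigenvalue must be the Rayleigh quotient; eliminating it leaves a condition closed in the
pair of matrix and vector. -/
theorem Matrix.exists_hasEigenvector_iff {n : ℕ} (M : Matrix (Fin n) (Fin n) ℝ)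
    {v : EuclideanSpace ℝ (Fin n)} (hv : ‖v‖ = 1) :
    (∃ c, Module.End.HasEigenvector M.toEuclideanLin c v) ↔
      M.mulVec v.ofLp = (v.ofLp ⬝ᵥ M.mulVec v.ofLp) • v.ofLp := by
  have hv0 : v ≠ 0 := by rintro rfl; simp at hv
  have hvv : v.ofLp ⬝ᵥ v.ofLp = 1 := by
    have := real_inner_self_eq_norm_sq v
    rw [hv, EuclideanSpace.inner_eq_star_dotProduct] at this
    simpa using this
  constructor
  · rintro ⟨c, h⟩
    rw [M.mulVec_of_hasEigenvector h, dotProduct_smul, hvv, smul_eq_mul, mul_one]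
  · intro h
    refine ⟨_, Module.End.mem_eigenspace_iff.2 (?_ : _ = (v.ofLp ⬝ᵥ M.mulVec v.ofLp) • v), hv0⟩
    rw [Matrix.toLpLin_apply, h, WithLp.toLp_smul]
    simp only [dotProduct_smul, hvv, smul_eq_mul, mul_one]

/-- The strict inequality is exhausted by closed conditions with margin `1 / (k + 1)`. Projecting
along the compact unit sphere keeps them closed, so the event is a countable union of closed sets.
-/
theorem measurableSet_hasNearlyOrthogonalEigenvector {n : ℕ} {F : Type*} [TopologicalSpace F]
    [MeasurableSpace F] [OpensMeasurableSpace (F × EuclideanSpace ℝ (Fin n))]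
    {S : F → Matrix (Fin n) (Fin n) ℝ} (hS : Continuous S) (t : ℝ) :
    MeasurableSet {p : F × EuclideanSpace ℝ (Fin n) |
      HasNearlyOrthogonalEigenvector (S p.1) t p.2} := by
  let C : ℕ → Set ((F × EuclideanSpace ℝ (Fin n)) ×
      Metric.sphere (0 : EuclideanSpace ℝ (Fin n)) 1) := fun k =>
    {q | (S q.1.1).mulVec q.2.1.ofLp
        = (q.2.1.ofLp ⬝ᵥ (S q.1.1).mulVec q.2.1.ofLp) • q.2.1.ofLp} ∩
    {q | |inner ℝ q.2.1 q.1.2| ≤ t * ‖q.1.2‖ - 1 / ((k : ℝ) + 1)}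
  have hC : ∀ k, IsClosed (C k) := by
    intro k
    have hv : Continuous fun q : (F × EuclideanSpace ℝ (Fin n)) ×
        Metric.sphere (0 : EuclideanSpace ℝ (Fin n)) 1 => q.2.1.ofLp := by fun_prop
    have hSv : Continuous fun q : (F × EuclideanSpace ℝ (Fin n)) ×
        Metric.sphere (0 : EuclideanSpace ℝ (Fin n)) 1 => (S q.1.1).mulVec q.2.1.ofLp :=
      (hS.comp (continuous_fst.comp continuous_fst)).matrix_mulVec hv
    refine (isClosed_eq hSv ((hv.dotProduct hSv).smul hv)).inter (isClosed_le ?_ ?_)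
    · fun_prop
    · fun_prop
  have hunion : {p : F × EuclideanSpace ℝ (Fin n) |
      HasNearlyOrthogonalEigenvector (S p.1) t p.2} = ⋃ k, Prod.fst '' C k := by
    ext p
    simp only [Set.mem_iUnion, Set.mem_image]
    constructor
    · rintro ⟨v, c, h1, h2, h3⟩
      obtain ⟨k, hk⟩ := exists_nat_one_div_lt (sub_pos.2 h3)
      refine ⟨k, ⟨p, v, mem_sphere_zero_iff_norm.2 h2⟩,
        ⟨(Matrix.exists_hasEigenvector_iff _ h2).1 ⟨c, h1⟩, ?_⟩, rfl⟩
      change |inner ℝ v p.2| ≤ t * ‖p.2‖ - 1 / ((k : ℝ) + 1)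
      linarith
    · rintro ⟨k, ⟨p, v, hv⟩, ⟨h1, h2⟩, rfl⟩
      have hv1 := mem_sphere_zero_iff_norm.1 hv
      obtain ⟨c, hc⟩ := (Matrix.exists_hasEigenvector_iff _ hv1).2 h1
      refine ⟨v, c, hc, hv1, lt_of_le_of_lt h2 ?_⟩
      have : 0 < 1 / ((k : ℝ) + 1) := by positivity
      change t * ‖p.2‖ - 1 / ((k : ℝ) + 1) < _
      linarith
  rw [hunion]
  exact MeasurableSet.iUnion fun k => (isClosedMap_fst_of_compactSpace _ (hC k)).measurableSet

theorem continuous_goeMatrix (n : ℕ) : Continuous (goeMatrix n) :=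
  continuous_matrix fun i j => by
    simp only [goeMatrix_apply]
    fun_prop

theorem measurableSet_goeMatrix_hasNearlyOrthogonalEigenvector {n : ℕ} (t : ℝ)
    (u : EuclideanSpace ℝ (Fin n)) :
    MeasurableSet {Y | HasNearlyOrthogonalEigenvector (goeMatrix n Y) t u} :=
  measurable_prodMk_right
    (measurableSet_hasNearlyOrthogonalEigenvector (continuous_goeMatrix n) t)

/-- Rotation invariance of the Gaussian orthogonal ensemble. -/
theorem stdGaussian_hasNearlyOrthogonalEigenvector_eq {n : ℕ} (t : ℝ)
    {u b : EuclideanSpace ℝ (Fin n)} (hu : u ≠ 0) (hb : b ≠ 0) :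
    stdGaussian _ {Y | HasNearlyOrthogonalEigenvector (goeMatrix n Y) t u}
      = stdGaussian _ {Y | HasNearlyOrthogonalEigenvector (goeMatrix n Y) t b} := by
  have hu' := norm_pos_iff.2 hu
  have hb' := norm_pos_iff.2 hb
  set r := ‖b‖ / ‖u‖ with hr
  have hr0 : 0 < r := div_pos hb' hu'
  have hru : ‖r • u‖ = ‖b‖ := by
    rw [norm_smul, Real.norm_of_nonneg hr0.le, hr, div_mul_cancel₀ _ hu'.ne']
  have hdot : (r • u).ofLp ⬝ᵥ (r • u).ofLp = b.ofLp ⬝ᵥ b.ofLp := by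
    have key : ∀ x : EuclideanSpace ℝ (Fin n), x.ofLp ⬝ᵥ x.ofLp = ‖x‖ ^ 2 := fun x => by
      rw [EuclideanSpace.real_norm_sq_eq]
      simp [dotProduct, pow_two]
    rw [key, key, hru]
  obtain ⟨Q, hQ, hQ2, hQu⟩ := exists_householder hdot
  have hQb : Q.mulVec b.ofLp = (r • u).ofLp := by
    rw [← hQu, Matrix.mulVec_mulVec, hQ2, Matrix.one_mulVec]
  obtain ⟨ρ, hρ⟩ := exists_linearIsometryEquiv_goeMatrix hQ hQ2
  rw [← stdGaussian_map ρ, Measure.map_apply (by fun_prop)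
    (measurableSet_goeMatrix_hasNearlyOrthogonalEigenvector t b), stdGaussian_map ρ]
  congr 1
  ext Y
  simp only [Set.mem_preimage, Set.mem_ofPred_eq, hρ]
  constructor
  · intro h
    have := (h.smul hr0).conj hQ hQ2
    rwa [hQu] at this
  · intro h
    have := (h.conj hQ hQ2).smul (inv_pos.2 hr0)
    rw [hQb] at this
    have h3 : Q * (Q * goeMatrix n Y * Q) * Q = goeMatrix n Y := by
      rw [Matrix.mul_assoc, Matrix.mul_assoc, hQ2, Matrix.mul_one, ← Matrix.mul_assoc, hQ2,
        Matrix.one_mul]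
    rw [h3] at this
    simpa [smul_smul, inv_mul_cancel₀ hr0.ne'] using this

/-! ### Almost sure simplicity of the spectrum -/

/-- Every line in the direction of a diagonal matrix with distinct entries meets the zero set of the
determinant in finitely many points, by a Vandermonde determinant. The zero set is therefore
Lebesgue-null. -/
theorem ae_det_krylov_goeMatrix_ne_zero (n : ℕ) :
    ∀ᵐ Y ∂stdGaussian (EuclideanSpace ℝ {p : Fin n × Fin n // p.1 ≤ p.2}),
      ((goeMatrix n Y).krylov (fun _ => 1)).det ≠ 0 := by
  refine (Measure.absolutelyContinuous_of_le (stdGaussian_le_volume _)).ae_le ?_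
  set D : Matrix (Fin n) (Fin n) ℝ := Matrix.diagonal fun i => (i : ℝ) with hD
  have hDK : (D.krylov (fun _ => 1)).det ≠ 0 :=
    Matrix.det_krylov_diagonal_ne_zero fun i j h => Fin.ext (by exact_mod_cast h)
  have hDsymm : goeMatrix n (goeCoord n D) = D :=
    goeMatrix_goeCoord (Matrix.isSymm_diagonal _)
  have hcont : Continuous fun Y => ((goeMatrix n Y).krylov (fun _ => 1)).det := by
    refine Continuous.matrix_det (continuous_matrix fun k i => ?_)
    have : Continuous fun Y => ((goeMatrix n Y) ^ (k : ℕ)).mulVec (fun _ => (1 : ℝ)) :=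
      ((continuous_goeMatrix n).pow k).matrix_mulVec continuous_const
    exact (continuous_apply i).comp this
  refine ae_mem_of_ae_add_linearMap_mem
    (LinearMap.toSpanSingleton ℝ _ (goeCoord n D)) volume volume
    (s := {Y | ((goeMatrix n Y).krylov (fun _ => 1)).det ≠ 0})
    (isOpen_ne_fun hcont continuous_const).measurableSet fun Y => ?_
  have := (Matrix.finite_setOf_det_krylov_add_smul_eq_zero (goeMatrix n Y) D (fun _ => 1)
    hDK).measure_zero volume
  refine measure_mono_null (fun x hx => ?_) this
  simpa [hDsymm] using hx

/-! ### Union bound and averaging over the vector -/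

theorem volume_hasNearlyOrthogonalEigenvector_le {k : ℕ} {t : ℝ} (ht0 : 0 ≤ t) (ht1 : t ≤ 1)
    {M : Matrix (Fin (k + 2)) (Fin (k + 2)) ℝ} (hM : M.IsSymm) {w : Fin (k + 2) → ℝ}
    (hK : (M.krylov w).det ≠ 0) :
    volume (Metric.ball 0 1 ∩ {u | HasNearlyOrthogonalEigenvector M t u})
      ≤ (k + 2 : ℕ) * (ENNReal.ofReal (1 - (1 - t) ^ (k + 1))
        * volume (Metric.ball (0 : EuclideanSpace ℝ (Fin (k + 2))) 1)) := by
  have hH : M.IsHermitian := hM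
  calc _ ≤ volume (⋃ i, {u : EuclideanSpace ℝ (Fin (k + 2)) |
          ‖u‖ < 1 ∧ |inner ℝ (hH.eigenvectorBasis i) u| < t * ‖u‖}) := by
        refine measure_mono ?_
        rintro u ⟨hu, v, c, h1, h2, h3⟩
        obtain ⟨i, hi⟩ := hH.exists_abs_inner_eigenvectorBasis_eq hK h1 h2
        exact Set.mem_iUnion.2 ⟨i, mem_ball_zero_iff.1 hu, (hi u).trans_lt h3⟩
    _ ≤ ∑ i, volume {u : EuclideanSpace ℝ (Fin (k + 2)) |
          ‖u‖ < 1 ∧ |inner ℝ (hH.eigenvectorBasis i) u| < t * ‖u‖} :=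
        measure_iUnion_fintype_le _ _
    _ ≤ ∑ _i : Fin (k + 2), ENNReal.ofReal (1 - (1 - t) ^ (k + 1))
        * volume (Metric.ball (0 : EuclideanSpace ℝ (Fin (k + 2))) 1) :=
        Finset.sum_le_sum fun i _ =>
          volume_abs_inner_lt_le ht0 ht1 (hH.eigenvectorBasis.orthonormal.1 i)
    _ = _ := by simp

/-- The product measure of the event on pairs `(Y, u)`, with `u` in the unit ball, is evaluated in
both orders. Slices at fixed `u ≠ 0` all have the probability sought; slices at fixed `Y` obey the
union bound. The volume of the ball cancels. -/
theorem stdGaussian_hasNearlyOrthogonalEigenvector_le {k : ℕ} {t : ℝ} (ht0 : 0 ≤ t) (ht1 : t ≤ 1)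
    {b : EuclideanSpace ℝ (Fin (k + 2))} (hb : b ≠ 0) :
    stdGaussian _ {Y | HasNearlyOrthogonalEigenvector (goeMatrix (k + 2) Y) t b}
      ≤ (k + 2 : ℕ) * ENNReal.ofReal (1 - (1 - t) ^ (k + 1)) := by
  set B : Set (EuclideanSpace ℝ (Fin (k + 2))) := Metric.ball 0 1 with hB
  have hBpos : volume B ≠ 0 := (Metric.measure_ball_pos volume 0 one_pos).ne'
  have hBtop : volume B ≠ ⊤ := measure_ball_lt_top.ne
  set μ := stdGaussian (EuclideanSpace ℝ {p : Fin (k + 2) × Fin (k + 2) // p.1 ≤ p.2}) with hμ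
  have hS := measurableSet_hasNearlyOrthogonalEigenvector (continuous_goeMatrix (k + 2)) t
  have h1 := Measure.prod_apply (μ := μ) (ν := volume.restrict B) hS
  rw [Measure.prod_apply_symm hS] at h1
  have h2 : ∀ᵐ u ∂(volume.restrict B), μ ((fun Y => (Y, u)) ⁻¹'
      {p | HasNearlyOrthogonalEigenvector (goeMatrix (k + 2) p.1) t p.2})
      = μ {Y | HasNearlyOrthogonalEigenvector (goeMatrix (k + 2) Y) t b} := by
    have : ∀ᵐ u ∂(volume.restrict B), u ≠ 0 := ae_restrict_of_ae (by simp [ae_iff])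
    filter_upwards [this] with u hu
    exact stdGaussian_hasNearlyOrthogonalEigenvector_eq t hu hb
  rw [lintegral_congr_ae h2, lintegral_const, Measure.restrict_apply_univ] at h1
  have h3 : ∫⁻ Y, volume.restrict B (Prod.mk Y ⁻¹'
      {p | HasNearlyOrthogonalEigenvector (goeMatrix (k + 2) p.1) t p.2}) ∂μ
      ≤ ∫⁻ _, (k + 2 : ℕ) * (ENNReal.ofReal (1 - (1 - t) ^ (k + 1)) * volume B) ∂μ := by
    refine lintegral_mono_ae ?_
    filter_upwards [ae_det_krylov_goeMatrix_ne_zero (k + 2)] with Y hY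
    rw [Measure.restrict_apply (measurable_prodMk_left hS), Set.inter_comm]
    have hY' := volume_hasNearlyOrthogonalEigenvector_le ht0 ht1 (isSymm_goeMatrix Y) hY
    refine le_trans (measure_mono ?_) hY'
    rintro u ⟨hu, hu'⟩
    exact ⟨hu, hu'⟩
  rw [← h1, lintegral_const, measure_univ, mul_one, ← mul_assoc] at h3
  exact (ENNReal.mul_le_mul_iff_left hBpos hBtop).1 h3

/-! ### Dimension one and conclusion -/

theorem not_hasNearlyOrthogonalEigenvector_fin_one {M : Matrix (Fin 1) (Fin 1) ℝ} {t : ℝ}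
    {u : EuclideanSpace ℝ (Fin 1)} (ht : t ≤ 1) : ¬ HasNearlyOrthogonalEigenvector M t u := by
  rintro ⟨v, c, -, hv, h⟩
  have h1 : |inner ℝ v u| = ‖v‖ * ‖u‖ := by
    simp [EuclideanSpace.norm_eq, EuclideanSpace.inner_eq_star_dotProduct, Real.sqrt_sq_eq_abs,
      dotProduct, abs_mul, mul_comm]
  rw [h1, hv, one_mul] at h
  nlinarith [norm_nonneg u]

theorem uncontrollability_le_stdGaussian {Ω : Type*} [MeasurableSpace Ω] {P : Measure Ω}
    [IsProbabilityMeasure P] {n : ℕ} {A : Ω → Matrix (Fin n) (Fin n) ℝ} (hA : IsGOE P A)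
    {b : EuclideanSpace ℝ (Fin n)} (hb : b ≠ 0) (ε : ℝ) :
    uncontrollability P A b ε
      ≤ (stdGaussian _).real {Y | HasNearlyOrthogonalEigenvector (goeMatrix n Y) (ε / ‖b‖) b} := by
  rw [uncontrollability, ← hA.hasLaw_goeCoord.measureReal_eq
    (measurableSet_goeMatrix_hasNearlyOrthogonalEigenvector (ε / ‖b‖) b)]
  refine ENNReal.toReal_mono (measure_ne_top _ _) (measure_mono_ae ?_)
  filter_upwards [hA.isSymm] with ω hω
  rintro ⟨v, c, h1, h2, h3⟩
  refine ⟨v, c, ?_, h2, ?_⟩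
  · rwa [goeMatrix_goeCoord hω]
  · rwa [div_mul_cancel₀ _ (norm_ne_zero_iff.2 hb)]

theorem theorem5p3 {Ω : Type*} [MeasurableSpace Ω] (P : Measure Ω) [IsProbabilityMeasure P]
    (n : ℕ) (A : Ω → Matrix (Fin n) (Fin n) ℝ) (hA : IsGOE P A)
    (b : EuclideanSpace ℝ (Fin n)) (hb : b ≠ 0)
    (ε : ℝ) (hε : 0 < ε) (hεb : Odd n → ε ≤ ‖b‖) :
    uncontrollability P A b ε ≤ (n : ℝ) * (1 - (1 - ε / ‖b‖) ^ (n - 1)) := by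
  have hb' := norm_pos_iff.2 hb
  have ht0 : 0 ≤ ε / ‖b‖ := by positivity
  have hle := uncontrollability_le_stdGaussian hA hb ε
  rcases n with _ | _ | k
  · exact absurd (Subsingleton.elim b 0) hb
  -- For `n = 1` the exponent is `0`, so the claimed bound is `0` and the event must be empty.
  · have ht1 : ε / ‖b‖ ≤ 1 := (div_le_one hb').2 (hεb odd_one)
    simpa [not_hasNearlyOrthogonalEigenvector_fin_one ht1] using hle
  · rcases le_or_gt (ε / ‖b‖) 1 with ht1 | ht1
    · refine hle.trans (ENNReal.toReal_le_of_le_ofReal ?_ ?_)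
      · have : (1 - ε / ‖b‖) ^ (k + 1) ≤ 1 := pow_le_one₀ (by linarith) (by linarith)
        exact mul_nonneg (Nat.cast_nonneg _) (by simpa using this)
      · rw [ENNReal.ofReal_mul (Nat.cast_nonneg _), ENNReal.ofReal_natCast]
        exact stdGaussian_hasNearlyOrthogonalEigenvector_le ht0 ht1 hb
    -- If `ε > ‖b‖` then `n = k + 2` is even, so the odd power of the negative number `1 - ε / ‖b‖`
    -- is at most `0` and the right-hand side is at least `n ≥ 1`.
    · have hodd : Odd (k + 1) := by
        rw [← Nat.not_even_iff_odd]
        intro h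
        exact absurd (hεb h.add_one) (not_le.2 ((one_lt_div hb').1 ht1))
      have h1 : (1 - ε / ‖b‖) ^ (k + 1) ≤ 0 := hodd.pow_nonpos (by linarith)
      have h2 : uncontrollability P A b ε ≤ 1 := hle.trans measureReal_le_one
      refine h2.trans ?_
      have h3 : (1 : ℝ) ≤ ((k + 1 + 1 : ℕ) : ℝ) := by exact_mod_cast Nat.le_add_left 1 (k + 1)
      change (1 : ℝ) ≤ ((k + 1 + 1 : ℕ) : ℝ) * (1 - (1 - ε / ‖b‖) ^ (k + 1))
      nlinarith
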